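/- Let $d\ge 1$ be an integer and write $B(x,r)$ for the closed ball in $\mathbb{R}^d$ with centre $x$ and radius $r$. The upper correlation dimension of a Borel probability measure $\mu$ on $\mathbb{R}^d$ is $$\overline{\dim}_C\,\mu=\limsup_{r\to 0^+}\frac{\log\int\mu(B(x,r))\,\mathrm{d}\mu(x)}{\log r},$$ and that of a Borel set $E\subset\mathbb{R}^d$ is $\overline{\dim}_C E=\sup_\mu\overline{\dim}_C\,\mu$, the supremum being over all Borel probability measures $\mu$ supported by $E$ (that is, $\mu(\mathbb{R}^d\setminus E)=0$). The packing dimension of $E$ is $\dim_P E=\inf\{u\ge 0:\mathcal{P}^u(E)=0\}$, where $$\mathcal{P}^u(E)=\inf\Big\{\sum_{i=1}^\infty\mathcal{P}^u_0(E_i):E\subset\bigcup_{i=1}^\infty E_i\Big\},\qquad \mathcal{P}^u_0(E)=\inf_{\delta>0}\,\sup\sum_i|B_i|^u,$$ the last supremum being over all finite or countable families $\{B_i\}_i$ of disjoint closed balls with centres in $E$ and positive radii at most $\delta$, and $|B_i|$ denoting the diameter of $B_i$. Then for all real numbers $s,t$ with $0<t<s<1$ there exists a compact set $E\subset\mathbb{R}^d$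 such that $\overline{\dim}_C E=t$ and $\dim_P E=s$. -/

import Mathlib

open MeasureTheory Filter Topology
open scoped NNReal ENNReal

/-- The correlation integral `∫ μ(B(x,r)) dμ(x)`, where `B(x,r)` is the closed ball. -/
noncomputable def correlationIntegral {X : Type*} [PseudoMetricSpace X] [MeasurableSpace X]
    (μ : Measure X) (r : ℝ) : ℝ≥0∞ :=
  ∫⁻ x, μ (Metric.closedBall x r) ∂μ

/-- The upper correlation dimension of a (probability) measure,
`limsup_{r → 0+} log (∫ μ(B(x,r)) dμ(x)) / log r`, as an extended real number. -/
noncomputable def upperCorrelationDimMeasure {X : Type*} [PseudoMetricSpace X]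
    [MeasurableSpace X] (μ : Measure X) : EReal :=
  limsup (fun r : ℝ => ((Real.log (correlationIntegral μ r).toReal / Real.log r : ℝ) : EReal))
    (𝓝[>] (0 : ℝ))

/-- The upper correlation dimension of a set `E`: the supremum of the upper correlation dimensions
of the probability measures supported by `E`. -/
noncomputable def upperCorrelationDim {X : Type*} [PseudoMetricSpace X] [MeasurableSpace X]
    (E : Set X) : EReal :=
  ⨆ (μ : Measure X) (_ : IsProbabilityMeasure μ) (_ : μ Eᶜ = 0), upperCorrelationDimMeasure μ

/-- `P` is a `δ`-packing of `E`: a finite or countable family of disjoint closed balls with centres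
in `E` and (positive) radii at most `δ`. A ball is recorded by its centre and its radius. -/
structure IsDeltaPacking {X : Type*} [PseudoMetricSpace X] (δ : ℝ) (E : Set X)
    (P : Set (X × ℝ)) : Prop where
  countable : P.Countable
  center_mem : ∀ p ∈ P, p.1 ∈ E
  radius_pos : ∀ p ∈ P, 0 < p.2
  radius_le : ∀ p ∈ P, p.2 ≤ δ
  disjoint : P.PairwiseDisjoint (fun p => Metric.closedBall p.1 p.2)

/-- The supremum of `∑ |B_i| ^ s` over the `δ`-packings `{B_i}` of `E`, where `|B|` is the diameter
of `B`. -/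
noncomputable def packingPremeasureDelta {X : Type*} [PseudoMetricSpace X] (s : ℝ≥0) (δ : ℝ)
    (E : Set X) : ℝ≥0∞ :=
  ⨆ (P : Set (X × ℝ)) (_ : IsDeltaPacking δ E P),
    ∑' p : P, (Metric.ediam (Metric.closedBall p.1.1 p.1.2)) ^ (s : ℝ)

/-- The `s`-dimensional packing premeasure. -/
noncomputable def packingPremeasure {X : Type*} [PseudoMetricSpace X] (s : ℝ≥0)
    (E : Set X) : ℝ≥0∞ :=
  ⨅ (δ : ℝ) (_ : 0 < δ), packingPremeasureDelta s δ E

/-- The `s`-dimensional packing measure. -/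
noncomputable def packingMeasure {X : Type*} [PseudoMetricSpace X] (s : ℝ≥0)
    (E : Set X) : ℝ≥0∞ :=
  ⨅ (U : ℕ → Set X) (_ : E ⊆ ⋃ i, U i), ∑' i, packingPremeasure s (U i)

/-- The packing dimension `inf {s ≥ 0 : 𝒫^s(E) = 0}`. -/
noncomputable def packingDim {X : Type*} [PseudoMetricSpace X] (E : Set X) : ℝ≥0∞ :=
  ⨅ (s : ℝ≥0) (_ : packingMeasure s E = 0), (s : ℝ≥0∞)

/-! The set is the isometric image, on a coordinate axis, of a union of two compact subsets of the
line: the self-similar set `K` with two maps of ratio `l`, `l ^ t = 1 / 2`, and `branchCompact s`,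
which has packing dimension `s` but upper correlation dimension `0`.

The correlation integral ignores complexity confined to one small ball per scale. If a measure gives
every ball of some fixed radius mass below `1 / 2`, then at least half of it lies outside the
exceptional ball, and a cover of that remainder by `N` balls of radius `r / 2` forces the integral
to be at least `1 / (16 N)`; otherwise the integral stays bounded below. Hence
`upperCorrelationDim_le_of_hasBallCover`, where the exceptional ball may depend on the scale.

`branchCompact s` exploits this. Step `k` attaches to an old point about `r_k ^ (-s)` points with
gap `r_k`, within distance `ρ_k = r_k ^ (1 - s)`. The `ρ_k` decrease so fast that between the scales
`ρ_(k+1)` and `ρ_k` everything outside the ball carrying the branch of step `k` needs only `q ^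
(-ε)` balls of radius `q / 2`. With the branch included the count is `O(q ^ (-s))`, so the packing
dimension is at most `s`. Every point branches infinitely often, so each relatively open piece
contains such rich clusters at arbitrarily small scales, and Baire's theorem gives packing dimension
at least `s` (`le_packingDim`).

`K` needs about `q ^ (-t)` balls, which leaves both upper bounds intact because `t < s`. Its coin
tossing measure provides the lower bound `t` for the correlation dimension. -/

/-- `A` is covered by at most `N` closed balls of radius `r`. -/
def HasBallCover {X : Type*} [PseudoMetricSpace X] (A : Set X) (r N : ℝ) : Prop :=
  ∃ T : Finset X, (T.card : ℝ) ≤ N ∧ A ⊆ ⋃ c ∈ T, Metric.closedBall c r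

/-! ### Elementary operations on ball covers, and the choice of scales -/

namespace HasBallCover

variable {X Y : Type*} [PseudoMetricSpace X] [PseudoMetricSpace Y] {A B : Set X} {r r' N M : ℝ}

theorem mono (h : HasBallCover B r N) (hA : A ⊆ B) (hr : r ≤ r') (hN : N ≤ M) :
    HasBallCover A r' M := by
  obtain ⟨T, hT, hB⟩ := h
  refine ⟨T, hT.trans hN, (hA.trans hB).trans ?_⟩
  exact Set.iUnion₂_mono fun c _ => Metric.closedBall_subset_closedBall hr

theorem union (hA : HasBallCover A r N) (hB : HasBallCover B r M) :
    HasBallCover (A ∪ B) r (N + M) := by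
  classical
  obtain ⟨T, hT, hA⟩ := hA
  obtain ⟨S, hS, hB⟩ := hB
  refine ⟨T ∪ S, ?_, ?_⟩
  · have : ((T ∪ S).card : ℝ) ≤ T.card + S.card := by exact_mod_cast Finset.card_union_le T S
    linarith
  · rintro x (hx | hx)
    · obtain ⟨c, hc, hx⟩ := Set.mem_iUnion₂.1 (hA hx)
      exact Set.mem_iUnion₂.2 ⟨c, Finset.mem_union_left _ hc, hx⟩
    · obtain ⟨c, hc, hx⟩ := Set.mem_iUnion₂.1 (hB hx)
      exact Set.mem_iUnion₂.2 ⟨c, Finset.mem_union_right _ hc, hx⟩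

theorem image (hA : HasBallCover A r N) {f : X → Y} (hf : Isometry f) :
    HasBallCover (f '' A) r N := by
  classical
  obtain ⟨T, hT, hA⟩ := hA
  refine ⟨T.image f, le_trans (by exact_mod_cast Finset.card_image_le) hT, ?_⟩
  rintro _ ⟨x, hx, rfl⟩
  obtain ⟨c, hc, hx⟩ := Set.mem_iUnion₂.1 (hA hx)
  refine Set.mem_iUnion₂.2 ⟨f c, Finset.mem_image_of_mem f hc, ?_⟩
  rw [Metric.mem_closedBall, hf.dist_eq]
  exact hx

end HasBallCover

/-- Absorbs multiplicative constants into a slightly larger exponent; this is why the dimension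
criteria ask for a bound for every `b > a`. -/
theorem eventually_const_mul_rpow_neg_le (C : ℝ) {a b : ℝ} (hab : a < b) :
    ∀ᶠ r in 𝓝[>] (0 : ℝ), C * r ^ (-a) ≤ r ^ (-b) := by
  have h := (tendsto_rpow_neg_nhdsGT_zero (show a - b < 0 by linarith)).eventually_ge_atTop C
  filter_upwards [h, self_mem_nhdsWithin] with r hr hr0
  have hr0 : 0 < r := hr0
  calc C * r ^ (-a) ≤ r ^ (a - b) * r ^ (-a) := by gcongr
    _ = r ^ (-b) := by rw [← Real.rpow_add hr0]; ring_nf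

/-- Scale selection along a sequence decreasing to zero. -/
theorem eventually_exists_between {a : ℕ → ℝ} (ha : Antitone a) (hpos : ∀ n, 0 < a n)
    (hlim : Tendsto a atTop (𝓝 0)) (K : ℕ) :
    ∀ᶠ r in 𝓝[>] (0 : ℝ), ∃ k, K ≤ k ∧ a (k + 1) ≤ r ∧ r < a k := by
  classical
  filter_upwards [Ioo_mem_nhdsGT (hpos K)] with r hr
  have hex : ∃ k, a k ≤ r := (hlim.eventually (ge_mem_nhds hr.1)).exists
  have hspec := Nat.find_spec hex
  have hK : K < Nat.find hex := by
    by_contra! h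
    exact absurd (hr.2.trans_le (ha h)) (not_lt.2 hspec)
  refine ⟨Nat.find hex - 1, by omega, ?_, ?_⟩
  · rwa [Nat.sub_add_cancel (by omega)]
  · exact not_le.1 (Nat.find_min hex (by omega))

/-! ### Bounds for the correlation dimension -/

section Correlation

variable {X : Type*} [PseudoMetricSpace X] [MeasurableSpace X] {μ : Measure X}

theorem correlationIntegral_le_one [IsProbabilityMeasure μ] (r : ℝ) :
    correlationIntegral μ r ≤ 1 := by
  calc correlationIntegral μ r ≤ ∫⁻ _, 1 ∂μ := lintegral_mono fun x => prob_le_one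
    _ = 1 := by simp

theorem correlationIntegral_ne_top [IsProbabilityMeasure μ] (r : ℝ) :
    correlationIntegral μ r ≠ ∞ :=
  ((correlationIntegral_le_one r).trans_lt ENNReal.one_lt_top).ne

theorem mul_le_correlationIntegral {S : Set X} (hS : MeasurableSet S) {r : ℝ} {c : ℝ≥0∞}
    (h : ∀ x ∈ S, c ≤ μ (Metric.closedBall x r)) : c * μ S ≤ correlationIntegral μ r := by
  calc c * μ S = ∫⁻ _ in S, c ∂μ := by rw [setLIntegral_const]
    _ ≤ ∫⁻ x in S, μ (Metric.closedBall x r) ∂μ := setLIntegral_mono' hS h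
    _ ≤ _ := setLIntegral_le_lintegral _ _

variable [OpensMeasurableSpace X]

omit [MeasurableSpace X] [OpensMeasurableSpace X] in
theorem closedBall_half_subset {x c : X} {r : ℝ} (hx : x ∈ Metric.closedBall c (r / 2)) :
    Metric.closedBall c (r / 2) ⊆ Metric.closedBall x r := by
  intro y hy
  rw [Metric.mem_closedBall] at *
  linarith [dist_triangle y c x, dist_comm x c]

theorem measure_sq_le_correlationIntegral (x : X) (r : ℝ) :
    μ (Metric.closedBall x (r / 2)) * μ (Metric.closedBall x (r / 2))
      ≤ correlationIntegral μ r :=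
  mul_le_correlationIntegral Metric.isClosed_closedBall.measurableSet fun _ hy =>
    measure_mono (closedBall_half_subset hy)

/-- Covering balls of mass below `c = 1 / (4 #T)` carry at most `1 / 4` together, so the heavy ones
carry at least `1 / 4`. Around each point of a heavy ball, the ball of radius `r` contains that
heavy ball, so the integral is at least `c / 4`. -/
theorem le_correlationIntegral_of_hasBallCover [IsProbabilityMeasure μ] {A : Set X} {r N : ℝ}
    (hA : HasBallCover A (r / 2) N) (hμ : 1 / 2 ≤ μ.real A) :
    (16 * N)⁻¹ ≤ (correlationIntegral μ r).toReal := by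
  classical
  obtain ⟨T, hT, hAT⟩ := hA
  have hTpos : 0 < (T.card : ℝ) := by
    rcases T.eq_empty_or_nonempty with rfl | h
    · have : A = ∅ := by simpa using hAT
      simp [this] at hμ
      norm_num at hμ
    · exact_mod_cast h.card_pos
  set c : ℝ := (4 * (T.card : ℝ))⁻¹ with hc
  have hcpos : 0 < c := by positivity
  set G := T.filter fun x => c ≤ μ.real (Metric.closedBall x (r / 2)) with hG
  set S : Set X := ⋃ x ∈ G, Metric.closedBall x (r / 2) with hS
  have hSm : MeasurableSet S :=
    G.measurableSet_biUnion fun x _ => Metric.isClosed_closedBall.measurableSet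
  have hbad : μ.real (⋃ x ∈ T.filter fun x => ¬ c ≤ μ.real (Metric.closedBall x (r / 2)),
      Metric.closedBall x (r / 2)) ≤ 1 / 4 := by
    refine (measureReal_biUnion_finset_le _ _).trans ?_
    calc _ ≤ ∑ x ∈ T.filter fun x => ¬ c ≤ μ.real (Metric.closedBall x (r / 2)), c :=
          Finset.sum_le_sum fun x hx => (not_le.1 (Finset.mem_filter.1 hx).2).le
      _ ≤ ∑ x ∈ T, c := Finset.sum_le_sum_of_subset_of_nonneg (Finset.filter_subset _ _)
          fun _ _ _ => hcpos.le
      _ = 1 / 4 := by rw [Finset.sum_const, nsmul_eq_mul, hc]; field_simp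
  have hSμ : 1 / 4 ≤ μ.real S := by
    have h1 : μ.real A ≤ μ.real (S ∪ ⋃ x ∈ T.filter fun x =>
        ¬ c ≤ μ.real (Metric.closedBall x (r / 2)), Metric.closedBall x (r / 2)) := by
      refine measureReal_mono fun x hx => ?_
      obtain ⟨y, hy, hxy⟩ := Set.mem_iUnion₂.1 (hAT hx)
      by_cases h : c ≤ μ.real (Metric.closedBall y (r / 2))
      · exact Or.inl (Set.mem_iUnion₂.2 ⟨y, Finset.mem_filter.2 ⟨hy, h⟩, hxy⟩)
      · exact Or.inr (Set.mem_iUnion₂.2 ⟨y, Finset.mem_filter.2 ⟨hy, h⟩, hxy⟩)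
    have h2 := h1.trans (measureReal_union_le _ _)
    linarith
  have key : ENNReal.ofReal c * μ S ≤ correlationIntegral μ r := by
    refine mul_le_correlationIntegral hSm fun x hx => ?_
    obtain ⟨y, hy, hxy⟩ := Set.mem_iUnion₂.1 hx
    calc ENNReal.ofReal c ≤ μ (Metric.closedBall y (r / 2)) :=
          ENNReal.ofReal_le_of_le_toReal (Finset.mem_filter.1 hy).2
      _ ≤ _ := measure_mono (closedBall_half_subset hxy)
  have key' := ENNReal.toReal_mono (correlationIntegral_ne_top r) key
  rw [ENNReal.toReal_mul, ENNReal.toReal_ofReal hcpos.le] at key'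
  calc (16 * N)⁻¹ ≤ (16 * (T.card : ℝ))⁻¹ := by gcongr
    _ = c * (1 / 4) := by rw [hc]; field_simp; norm_num
    _ ≤ c * μ.real S := by gcongr
    _ ≤ _ := key'

omit [OpensMeasurableSpace X] in
theorem upperCorrelationDimMeasure_le_of_eventually [IsProbabilityMeasure μ] {a : ℝ}
    (h : ∀ᶠ r in 𝓝[>] (0 : ℝ), r ^ a ≤ (correlationIntegral μ r).toReal) :
    upperCorrelationDimMeasure μ ≤ (a : EReal) := by
  refine limsup_le_of_le (by isBoundedDefault) ?_
  filter_upwards [h, Ioo_mem_nhdsGT zero_lt_one] with r hr hr01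
  rw [EReal.coe_le_coe_iff, div_le_iff_of_neg (Real.log_neg hr01.1 hr01.2),
    ← Real.log_rpow hr01.1]
  exact Real.log_le_log (Real.rpow_pos_of_pos hr01.1 a) hr

/-- If, at every small scale `r`, all of `F` outside a small ball is covered by `r ^ (-b)` balls of
radius `r / 2`, for all `b > a`, then the upper correlation dimension of `F` is at most `a`. -/
theorem upperCorrelationDim_le_of_hasBallCover {F : Set X} {a : ℝ} (ha : 0 ≤ a)
    (h : ∀ b > a, ∀ η > 0, ∀ᶠ r in 𝓝[>] (0 : ℝ),
      ∃ x, HasBallCover (F \ Metric.closedBall x η) (r / 2) (r ^ (-b))) :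
    upperCorrelationDim F ≤ (a : EReal) := by
  refine iSup_le fun μ => iSup_le fun hμ => iSup_le fun hF => ?_
  suffices H : ∀ b > a, upperCorrelationDimMeasure μ ≤ (b : EReal) by
    refine EReal.le_of_forall_lt_iff_le.1 fun z hz => H z (EReal.coe_lt_coe_iff.1 hz)
  intro b hb
  obtain ⟨b', hab', hb'b⟩ := exists_between hb
  apply upperCorrelationDimMeasure_le_of_eventually
  -- Either the integral never drops below `1 / 4`, which beats `r ^ b` for small `r`, or it does so
  -- at some `r₀`, and then every ball of radius `r₀ / 2` has mass below `1 / 2`.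
  by_cases hatom : ∀ r > 0, 1 / 4 ≤ (correlationIntegral μ r).toReal
  · filter_upwards [eventually_const_mul_rpow_neg_le 4 (show (0 : ℝ) < b by linarith),
      self_mem_nhdsWithin] with r hr hr0
    have hr0 : 0 < r := hr0
    refine le_trans ?_ (hatom r hr0)
    rw [neg_zero, Real.rpow_zero, Real.rpow_neg hr0.le] at hr
    have hp : 0 < r ^ b := Real.rpow_pos_of_pos hr0 b
    rw [le_div_iff₀ (by norm_num)]
    have := mul_le_mul_of_nonneg_right hr hp.le
    rw [inv_mul_cancel₀ hp.ne'] at this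
    linarith
  · push Not at hatom
    obtain ⟨r₀, hr₀, hC⟩ := hatom
    filter_upwards [h b' hab' (r₀ / 2) (by positivity),
      eventually_const_mul_rpow_neg_le 16 hb'b, self_mem_nhdsWithin] with r hcov hr hr0
    have hr0 : 0 < r := hr0
    obtain ⟨x, hcov⟩ := hcov
    have hball : μ.real (Metric.closedBall x (r₀ / 2)) < 1 / 2 := by
      have := ENNReal.toReal_mono (correlationIntegral_ne_top r₀)
        (measure_sq_le_correlationIntegral (μ := μ) x r₀)
      rw [ENNReal.toReal_mul] at this
      have h' : μ.real (Metric.closedBall x (r₀ / 2)) * μ.real (Metric.closedBall x (r₀ / 2))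
        ≤ (correlationIntegral μ r₀).toReal := this
      nlinarith [measureReal_nonneg (μ := μ) (s := Metric.closedBall x (r₀ / 2))]
    have hrest : 1 / 2 ≤ μ.real (F \ Metric.closedBall x (r₀ / 2)) := by
      have h1 : (1 : ℝ) ≤ μ.real (Metric.closedBall x (r₀ / 2)) +
          μ.real (F \ Metric.closedBall x (r₀ / 2)) + μ.real Fᶜ := by
        calc (1 : ℝ) = μ.real Set.univ := by simp
          _ ≤ μ.real ((Metric.closedBall x (r₀ / 2) ∪ (F \ Metric.closedBall x (r₀ / 2))) ∪ Fᶜ) := by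
            refine measureReal_mono fun y _ => ?_
            by_cases h1 : y ∈ F <;> by_cases h2 : y ∈ Metric.closedBall x (r₀ / 2) <;>
              simp [h1, h2]
          _ ≤ _ := (measureReal_union_le _ _).trans (by gcongr; exact measureReal_union_le _ _)
      have h2 : μ.real Fᶜ = 0 := by simp [measureReal_def, hF]
      linarith
    refine le_trans ?_ (le_correlationIntegral_of_hasBallCover hcov hrest)
    rw [← neg_neg b, Real.rpow_neg hr0.le]
    have : 0 < r ^ (-b') := Real.rpow_pos_of_pos hr0 _
    gcongr

omit [OpensMeasurableSpace X] in
-- Positivity excludes the value `Real.log 0 = 0`, which would make the quotient vanish.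
theorem le_upperCorrelationDimMeasure_of_frequently {a : ℝ}
    (hpos : ∀ᶠ r in 𝓝[>] (0 : ℝ), 0 < (correlationIntegral μ r).toReal)
    (h : ∀ b < a, ∃ᶠ r in 𝓝[>] (0 : ℝ), (correlationIntegral μ r).toReal ≤ r ^ b) :
    (a : EReal) ≤ upperCorrelationDimMeasure μ := by
  refine EReal.ge_of_forall_gt_iff_ge.1 fun b hb => ?_
  refine le_limsup_of_frequently_le' ?_
  refine ((h b (EReal.coe_lt_coe_iff.1 hb)).and_eventually
    (hpos.and (Ioo_mem_nhdsGT zero_lt_one))).mono ?_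
  rintro r ⟨hr, hC, hr01⟩
  rw [EReal.coe_le_coe_iff, le_div_iff_of_neg (Real.log_neg hr01.1 hr01.2),
    ← Real.log_rpow hr01.1]
  exact Real.log_le_log hC hr

end Correlation

/-! ### Bounds for the packing dimension -/

section Packing

theorem packingPremeasureDelta_empty {X : Type*} [PseudoMetricSpace X] (u : ℝ≥0) (δ : ℝ) :
    packingPremeasureDelta u δ (∅ : Set X) = 0 := by
  refine le_antisymm (iSup₂_le fun P hP => ?_) zero_le
  have : IsEmpty P := ⟨fun p => hP.center_mem p p.2⟩
  simp

theorem packingPremeasure_empty {X : Type*} [PseudoMetricSpace X] (u : ℝ≥0) :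
    packingPremeasure u (∅ : Set X) = 0 :=
  le_antisymm ((iInf₂_le 1 one_pos).trans (packingPremeasureDelta_empty u 1).le) zero_le

theorem packingMeasure_le_packingPremeasure {X : Type*} [PseudoMetricSpace X] (u : ℝ≥0)
    (F : Set X) : packingMeasure u F ≤ packingPremeasure u F := by
  refine (iInf₂_le (fun i : ℕ => if i = 0 then F else ∅) ?_).trans ?_
  · exact fun x hx => Set.mem_iUnion.2 ⟨0, by simpa using hx⟩
  · rw [tsum_eq_single 0 fun i hi => by simp [hi, packingPremeasure_empty]]
    simp

/-- In a packing, the balls with radius in `(r, r']` and centres in `F` are at most as many as the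
balls of radius `r / 2` needed to cover `F`. -/
theorem IsDeltaPacking.tsum_shell_le {X : Type*} [PseudoMetricSpace X] {F : Set X} {δ : ℝ}
    {P : Set (X × ℝ)} (hP : IsDeltaPacking δ F P) {r r' N u : ℝ} (hu : 0 ≤ u) (hr' : 0 ≤ r')
    (hcov : HasBallCover F (r / 2) N) :
    ∑' p : {p ∈ P | r < p.2 ∧ p.2 ≤ r'}, Metric.ediam (Metric.closedBall p.1.1 p.1.2) ^ u
      ≤ ENNReal.ofReal (N * (2 * r') ^ u) := by
  classical
  obtain ⟨T, hT, hFT⟩ := hcov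
  have hmem : ∀ p : {p ∈ P | r < p.2 ∧ p.2 ≤ r'}, ∃ c : T,
      p.1.1 ∈ Metric.closedBall c.1 (r / 2) := fun p => by
    obtain ⟨c, hc, h⟩ := Set.mem_iUnion₂.1 (hFT (hP.center_mem p.1 p.2.1))
    exact ⟨⟨c, hc⟩, h⟩
  choose g hg using hmem
  -- Two centres assigned to one ball of radius `r / 2` are at distance at most `r`, less than
  -- either radius, so their balls would meet.
  have hinj : Function.Injective g := by
    intro p q hpq
    by_contra hne
    have hd := hP.disjoint p.2.1 q.2.1 (fun h => hne (Subtype.ext h))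
    refine Set.disjoint_left.1 hd (Metric.mem_closedBall_self (hP.radius_pos _ p.2.1).le) ?_
    have hp := hg p
    rw [hpq] at hp
    have hq := hg q
    rw [Metric.mem_closedBall] at *
    have := dist_triangle p.1.1 (g q).1 q.1.1
    have := dist_comm q.1.1 (g q).1
    linarith [q.2.2.1]
  have hfin := Finite.of_injective g hinj
  have hfint := Fintype.ofFinite {p ∈ P | r < p.2 ∧ p.2 ≤ r'}
  have hcard : Fintype.card {p ∈ P | r < p.2 ∧ p.2 ≤ r'} ≤ T.card := by
    simpa using Fintype.card_le_of_injective g hinj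
  rw [tsum_fintype]
  calc _ ≤ ∑ p : {p ∈ P | r < p.2 ∧ p.2 ≤ r'}, ENNReal.ofReal ((2 * r') ^ u) := by
        refine Finset.sum_le_sum fun p _ => ?_
        rw [← ENNReal.ofReal_rpow_of_nonneg (by positivity) hu]
        refine ENNReal.rpow_le_rpow ?_ hu
        refine Metric.ediam_le fun x hx y hy => ?_
        rw [edist_dist]
        refine ENNReal.ofReal_le_ofReal ?_
        rw [Metric.mem_closedBall] at hx hy
        linarith [dist_triangle_right x y p.1.1, p.2.2.2]
    _ = ENNReal.ofReal (Fintype.card {p ∈ P | r < p.2 ∧ p.2 ≤ r'} * (2 * r') ^ u) := by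
        rw [Finset.sum_const, nsmul_eq_mul, ENNReal.ofReal_mul (by positivity)]
        simp
    _ ≤ _ := by
        refine ENNReal.ofReal_le_ofReal ?_
        gcongr
        exact le_trans (by exact_mod_cast hcard) hT

/-- Sorting the balls of a packing into dyadic shells of radii bounds the sum by a geometric series
of ratio `2 ^ (b - u) < 1`; its tail, the part with radii at most `δ`, tends to zero. -/
theorem packingPremeasure_eq_zero_of_hasBallCover {X : Type*} [PseudoMetricSpace X] {F : Set X}
    {b : ℝ} {u : ℝ≥0} (hbu : b < u)
    (h : ∀ᶠ r in 𝓝[>] (0 : ℝ), HasBallCover F (r / 2) (r ^ (-b))) :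
    packingPremeasure u F = 0 := by
  obtain ⟨r₀, hr₀, h⟩ := mem_nhdsGT_iff_exists_Ioc_subset.1 h
  have hr₀ : 0 < r₀ := hr₀
  set q : ℝ := (1 / 2 : ℝ) ^ ((u : ℝ) - b) with hq
  have hq0 : 0 < q := by positivity
  have hq1 : q < 1 := Real.rpow_lt_one (by norm_num) (by norm_num) (by linarith)
  set C : ℝ := r₀ ^ (-b) * (4 * r₀) ^ (u : ℝ) with hC
  have hC0 : 0 < C := by positivity
  -- the contribution of the balls with radius in `(r₀ 2⁻ʲ, 2 r₀ 2⁻ʲ]` is at most `C qʲ`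
  have hterm : ∀ j : ℕ, (r₀ * (1 / 2) ^ j) ^ (-b) * (2 * (2 * (r₀ * (1 / 2) ^ j))) ^ (u : ℝ)
      = C * q ^ j := by
    intro j
    have h2 : (0 : ℝ) < (1 / 2) ^ j := by positivity
    rw [Real.mul_rpow hr₀.le h2.le,
      show 2 * (2 * (r₀ * (1 / 2 : ℝ) ^ j)) = (4 * r₀) * (1 / 2) ^ j by ring,
      Real.mul_rpow (by positivity) h2.le, hC, hq, ← Real.rpow_natCast (_ ^ (_ - _)),
      ← Real.rpow_mul (by norm_num), mul_comm ((u : ℝ) - b), Real.rpow_mul (by norm_num),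
      Real.rpow_natCast, show (u : ℝ) - b = -b + u by ring, Real.rpow_add h2]
    ring
  have hdelta : ∀ J : ℕ, packingPremeasureDelta u (r₀ * (1 / 2) ^ J) F
      ≤ ENNReal.ofReal (C * q ^ J * (1 - q)⁻¹) := by
    intro J
    refine iSup₂_le fun P hP => ?_
    have hsub : P ⊆ ⋃ i : ℕ, {p ∈ P | r₀ * (1 / 2) ^ (J + i) < p.2 ∧
        p.2 ≤ 2 * (r₀ * (1 / 2) ^ (J + i))} := by
      intro p hp
      have hp0 := hP.radius_pos p hp
      have hpδ := hP.radius_le p hp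
      have hx : 0 < p.2 / (r₀ * (1 / 2) ^ J) := by positivity
      have hx1 : p.2 / (r₀ * (1 / 2) ^ J) ≤ 1 := by rw [div_le_one (by positivity)]; exact hpδ
      obtain ⟨n, hn1, hn2⟩ := exists_nat_pow_near_of_lt_one hx hx1
        (show (0 : ℝ) < 1 / 2 by norm_num) (by norm_num)
      refine Set.mem_iUnion.2 ⟨n + 1, hp, ?_, ?_⟩
      · rw [lt_div_iff₀ (by positivity)] at hn1
        calc r₀ * (1 / 2) ^ (J + (n + 1)) = (1 / 2) ^ (n + 1) * (r₀ * (1 / 2) ^ J) := by ring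
          _ < p.2 := hn1
      · rw [div_le_iff₀ (by positivity)] at hn2
        calc p.2 ≤ (1 / 2) ^ n * (r₀ * (1 / 2) ^ J) := hn2
          _ = _ := by ring
    calc ∑' p : P, Metric.ediam (Metric.closedBall p.1.1 p.1.2) ^ (u : ℝ)
        ≤ ∑' p : (⋃ i : ℕ, {p ∈ P | r₀ * (1 / 2) ^ (J + i) < p.2 ∧
            p.2 ≤ 2 * (r₀ * (1 / 2) ^ (J + i))}),
            Metric.ediam (Metric.closedBall p.1.1 p.1.2) ^ (u : ℝ) :=
          ENNReal.tsum_mono_subtype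
            (fun p : X × ℝ => Metric.ediam (Metric.closedBall p.1 p.2) ^ (u : ℝ)) hsub
      _ ≤ ∑' i : ℕ, ∑' p : {p ∈ P | r₀ * (1 / 2) ^ (J + i) < p.2 ∧
            p.2 ≤ 2 * (r₀ * (1 / 2) ^ (J + i))},
            Metric.ediam (Metric.closedBall p.1.1 p.1.2) ^ (u : ℝ) :=
          ENNReal.tsum_iUnion_le_tsum
            (fun p : X × ℝ => Metric.ediam (Metric.closedBall p.1 p.2) ^ (u : ℝ)) _
      _ ≤ ∑' i : ℕ, ENNReal.ofReal (C * q ^ J * q ^ i) := by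
          refine ENNReal.tsum_le_tsum fun i => ?_
          have hs : r₀ * (1 / 2) ^ (J + i) ∈ Set.Ioc 0 r₀ :=
            ⟨by positivity, mul_le_of_le_one_right hr₀.le
              (pow_le_one₀ (by norm_num) (by norm_num))⟩
          refine (hP.tsum_shell_le u.coe_nonneg (by positivity) (h hs)).trans ?_
          rw [hterm, pow_add, ← mul_assoc]
      _ = _ := by
          rw [← ENNReal.ofReal_tsum_of_nonneg (fun i => by positivity)
            ((summable_geometric_of_lt_one hq0.le hq1).mul_left _), tsum_mul_left,
            tsum_geometric_of_lt_one hq0.le hq1]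
  have hlim : Tendsto (fun J : ℕ => ENNReal.ofReal (C * q ^ J * (1 - q)⁻¹)) atTop (𝓝 0) := by
    rw [← ENNReal.ofReal_zero]
    refine ENNReal.tendsto_ofReal ?_
    simpa using ((tendsto_pow_atTop_nhds_zero_of_lt_one hq0.le hq1).const_mul C).mul_const
      (1 - q)⁻¹
  refine le_antisymm (ge_of_tendsto' hlim fun J => ?_) zero_le
  exact (iInf₂_le _ (by positivity)).trans (hdelta J)

theorem packingDim_le_of_hasBallCover {X : Type*} [PseudoMetricSpace X] {F : Set X} {a : ℝ}
    (ha : 0 ≤ a)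
    (h : ∀ b > a, ∀ᶠ r in 𝓝[>] (0 : ℝ), HasBallCover F (r / 2) (r ^ (-b))) :
    packingDim F ≤ ENNReal.ofReal a := by
  refine le_of_forall_gt_imp_ge_of_dense fun z hz => ?_
  obtain ⟨u, hau, huz⟩ := ENNReal.lt_iff_exists_nnreal_btwn.1 hz
  have hau : a < u := by
    rw [← ENNReal.ofReal_coe_nnreal] at hau
    exact (ENNReal.ofReal_lt_ofReal_iff_of_nonneg ha).1 hau
  obtain ⟨b, hab, hbu⟩ := exists_between hau
  refine le_trans (iInf₂_le u ?_) huz.le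
  exact le_antisymm ((packingMeasure_le_packingPremeasure u F).trans
    (packingPremeasure_eq_zero_of_hasBallCover hbu (h b hab)).le) zero_le

theorem le_ediam_closedBall {V : Type*} [NormedAddCommGroup V] [NormedSpace ℝ V] [Nontrivial V]
    (x : V) {r : ℝ} (hr : 0 ≤ r) : ENNReal.ofReal r ≤ Metric.ediam (Metric.closedBall x r) := by
  obtain ⟨e, he⟩ := exists_norm_eq V hr
  calc ENNReal.ofReal r = edist (x + e) x := by rw [edist_dist, dist_eq_norm]; simp [he]
    _ ≤ _ := Metric.edist_le_ediam_of_mem (by simp [he]) (Metric.mem_closedBall_self hr)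

/-- A set `U` whose closure contains many well separated points has large packing premeasure. -/
theorem one_le_packingPremeasure {V : Type*} [NormedAddCommGroup V] [NormedSpace ℝ V]
    [Nontrivial V] {U : Set V} {u : ℝ≥0}
    (h : ∀ δ > 0, ∃ r, 0 < r ∧ r ≤ δ ∧ ∃ (n : ℕ) (y : ℕ → V), (∀ j < n, y j ∈ closure U) ∧
      (∀ i < n, ∀ j < n, i ≠ j → r ≤ dist (y i) (y j)) ∧ 1 ≤ n * (r / 4) ^ (u : ℝ)) :
    1 ≤ packingPremeasure u U := by
  classical
  refine le_iInf₂ fun δ hδ => ?_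
  obtain ⟨r, hr, hrδ, n, y, hy, hsep, hn⟩ := h δ hδ
  -- Moving each point by less than `r / 10` into `U` keeps distances above `r / 2`, so balls of
  -- radius `r / 4` stay disjoint.
  have hz : ∀ j : Fin n, ∃ z ∈ U, dist (y j) z < r / 10 := fun j =>
    Metric.mem_closure_iff.1 (hy j j.2) _ (by positivity)
  choose z hzU hz using hz
  have hzsep : ∀ i j : Fin n, i ≠ j → r / 4 + r / 4 < dist (z i) (z j) := by
    intro i j hij
    have h1 := hsep i i.2 j j.2 (fun h => hij (Fin.ext h))
    have h2 := dist_triangle4 (y i) (z i) (z j) (y j)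
    have h3 := dist_comm (z j) (y j)
    linarith [hz i, hz j]
  have hzinj : Function.Injective fun j : Fin n => (z j, r / 4) := by
    intro i j hij
    by_contra hne
    have := hzsep i j hne
    have h0 : z i = z j := (Prod.ext_iff.1 hij).1
    rw [h0, dist_self] at this
    linarith
  have hP : IsDeltaPacking δ U (Set.range fun j : Fin n => (z j, r / 4)) := by
    refine ⟨Set.countable_range _, ?_, ?_, ?_, ?_⟩
    · rintro _ ⟨j, rfl⟩; exact hzU j
    · rintro _ ⟨j, rfl⟩; show 0 < r / 4; positivity
    · rintro _ ⟨j, rfl⟩; show r / 4 ≤ δ; linarith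
    · rintro _ ⟨i, rfl⟩ _ ⟨j, rfl⟩ hij
      refine Metric.closedBall_disjoint_closedBall (hzsep i j ?_)
      rintro rfl
      exact hij rfl
  refine le_trans ?_ (le_iSup₂ (f := fun (P : Set (V × ℝ)) (_ : IsDeltaPacking δ U P) =>
    ∑' p : P, Metric.ediam (Metric.closedBall p.1.1 p.1.2) ^ (u : ℝ)) _ hP)
  rw [tsum_range (fun p : V × ℝ => Metric.ediam (Metric.closedBall p.1 p.2) ^ (u : ℝ)) hzinj,
    tsum_fintype]
  calc (1 : ℝ≥0∞) ≤ ENNReal.ofReal (n * (r / 4) ^ (u : ℝ)) := by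
        rw [← ENNReal.ofReal_one]; exact ENNReal.ofReal_le_ofReal hn
    _ = ∑ _j : Fin n, ENNReal.ofReal (r / 4) ^ (u : ℝ) := by
        rw [Finset.sum_const, nsmul_eq_mul, ENNReal.ofReal_mul (by positivity),
          ENNReal.ofReal_rpow_of_nonneg (by positivity) u.coe_nonneg]
        simp
    _ ≤ _ := Finset.sum_le_sum fun j _ =>
        ENNReal.rpow_le_rpow (le_ediam_closedBall _ (by positivity)) u.coe_nonneg

/-- If near every point of a dense subset of a nonempty closed set `G ⊆ F` there are, at
arbitrarily small scales `r`, at least `(r / 4) ^ (-u)` points of `G` that are `r`-separated, for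
all `u < a`, then the packing dimension of `F` is at least `a`. -/
theorem le_packingDim {V : Type*} [NormedAddCommGroup V] [NormedSpace ℝ V] [Nontrivial V]
    [CompleteSpace V] {F G D : Set V} {a : ℝ} (hG : IsClosed G) (hGF : G ⊆ F) (hD : D.Nonempty)
    (hDG : G ⊆ closure D) (hDsub : D ⊆ G)
    (h : ∀ x ∈ D, ∀ O : Set V, IsOpen O → x ∈ O → ∀ u : ℝ, u < a → ∀ δ > 0,
      ∃ r, 0 < r ∧ r ≤ δ ∧ ∃ (n : ℕ) (y : ℕ → V), (∀ j < n, y j ∈ O ∩ G) ∧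
      (∀ i < n, ∀ j < n, i ≠ j → r ≤ dist (y i) (y j)) ∧ 1 ≤ n * (r / 4) ^ u) :
    ENNReal.ofReal a ≤ packingDim F := by
  refine le_iInf₂ fun u hu => ?_
  rw [ENNReal.ofReal_le_iff_le_toReal ENNReal.coe_ne_top, ENNReal.coe_toReal]
  by_contra! hua
  have hlt : packingMeasure u F < 1 := by rw [hu]; exact one_pos
  simp only [packingMeasure, iInf_lt_iff] at hlt
  obtain ⟨U, hFU, hsum⟩ := hlt
  have hlt : ∀ i, packingPremeasure u (U i) < 1 := fun i => (ENNReal.le_tsum i).trans_lt hsum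
  have : CompleteSpace G := hG.completeSpace_coe
  have : Nonempty G := (hD.mono hDsub).to_subtype
  -- Baire in the complete space `G`: the closure of some `U i` contains a relatively open part of
  -- `G`, which meets `D`.
  obtain ⟨i, x, hx⟩ := nonempty_interior_of_iUnion_of_closed
    (f := fun i => ((↑) : G → V) ⁻¹' closure (U i))
    (fun i => isClosed_closure.preimage continuous_subtype_val)
    (Set.eq_univ_of_forall fun x => by
      obtain ⟨i, hi⟩ := Set.mem_iUnion.1 (hFU (hGF x.2))
      exact Set.mem_iUnion.2 ⟨i, subset_closure hi⟩)
  obtain ⟨W, hWU, hWo, hxW⟩ := mem_interior.1 hx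
  obtain ⟨O, hO, rfl⟩ := isOpen_induced_iff.1 hWo
  obtain ⟨y, hyO, hyD⟩ := mem_closure_iff.1 (hDG x.2) O hO hxW
  refine (hlt i).not_ge (one_le_packingPremeasure fun δ hδ => ?_)
  obtain ⟨r, hr, hrδ, n, z, hz, hsep, hn⟩ := h y hyD O hO hyO u hua δ hδ
  exact ⟨r, hr, hrδ, n, z, fun j hj => hWU (a := ⟨z j, (hz j hj).2⟩) (hz j hj).1, hsep, hn⟩

end Packing

/-! ### The self-similar set of dimension `t` and its natural measure -/

section DigitSums

/-- The sum `∑ bᵢ lⁱ` of the `0-1` digits `b` in base `l⁻¹`. -/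
noncomputable def digitSum (l : ℝ) (b : ℕ → Bool) : ℝ := ∑' i, (if b i then 1 else 0) * l ^ i

variable {l : ℝ}

theorem norm_digit_mul_pow_le (hl : 0 ≤ l) (b : ℕ → Bool) (i : ℕ) :
    ‖(if b i then 1 else 0) * l ^ i‖ ≤ l ^ i := by
  have : 0 ≤ l ^ i := by positivity
  split_ifs <;> simp [abs_of_nonneg hl, this]

theorem summable_digit_mul_pow (hl : 0 ≤ l) (hl1 : l < 1) (b : ℕ → Bool) :
    Summable fun i => (if b i then 1 else 0) * l ^ i :=
  .of_norm_bounded (summable_geometric_of_lt_one hl hl1) (norm_digit_mul_pow_le hl b)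

theorem digitSum_eq (hl : 0 ≤ l) (hl1 : l < 1) (b : ℕ → Bool) :
    digitSum l b = (if b 0 then 1 else 0) + l * digitSum l fun i => b (i + 1) := by
  rw [digitSum, (summable_digit_mul_pow hl hl1 b).tsum_eq_zero_add, digitSum, ← tsum_mul_left]
  congr 1
  · simp
  · exact tsum_congr fun i => by ring

theorem digitSum_nonneg (hl : 0 ≤ l) (b : ℕ → Bool) : 0 ≤ digitSum l b :=
  tsum_nonneg fun i => by split_ifs <;> positivity

theorem digitSum_le (hl : 0 ≤ l) (hl1 : l < 1) (b : ℕ → Bool) : digitSum l b ≤ (1 - l)⁻¹ := by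
  rw [← tsum_geometric_of_lt_one hl hl1]
  exact (summable_digit_mul_pow hl hl1 b).tsum_le_tsum
    (fun i => (le_abs_self _).trans (norm_digit_mul_pow_le hl b i))
    (summable_geometric_of_lt_one hl hl1)

theorem continuous_digitSum (hl : 0 ≤ l) (hl1 : l < 1) : Continuous (digitSum l) := by
  refine continuous_tsum (fun i => ?_) (summable_geometric_of_lt_one hl hl1)
    (fun i b => norm_digit_mul_pow_le hl b i)
  exact ((continuous_of_discreteTopology (f := fun x : Bool => if x then (1 : ℝ) else 0)).comp
    (continuous_apply i)).mul continuous_const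

/-- If the first digits differ, the tails, which lie in `[0, 2 l]`, leave a gap of at least `1 - 2
l`. Otherwise remove the common digit and rescale by `l⁻¹`. -/
theorem digits_eq_of_abs_sub_lt (hl : 0 < l) (hl2 : l < 1 / 2) (n : ℕ) (b b' : ℕ → Bool)
    (h : |digitSum l b - digitSum l b'| < (1 - 2 * l) * l ^ n) : ∀ i < n, b i = b' i := by
  have hl1 : l < 1 := by linarith
  induction n generalizing b b' with
  | zero => simp
  | succ n ih =>
    have hpow : l ^ (n + 1) ≤ 1 := pow_le_one₀ hl.le hl1.le
    have hpos : 0 < l ^ (n + 1) := by positivity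
    have hbound : ∀ c : ℕ → Bool, l * digitSum l c ≤ 2 * l := fun c => by
      have := digitSum_le hl.le hl1 c
      have h2 : (1 - l)⁻¹ ≤ 2 := by
        rw [inv_le_comm₀ (by linarith) (by norm_num)]; linarith
      nlinarith
    have hnn : ∀ c : ℕ → Bool, 0 ≤ l * digitSum l c := fun c =>
      mul_nonneg hl.le (digitSum_nonneg hl.le c)
    have hsmall : (1 - 2 * l) * l ^ (n + 1) ≤ 1 - 2 * l :=
      mul_le_of_le_one_right (by linarith) hpow
    rw [digitSum_eq hl.le hl1 b, digitSum_eq hl.le hl1 b'] at h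
    have h0 : b 0 = b' 0 := by
      by_contra hne
      have hx := hbound fun i => b (i + 1)
      have hy := hbound fun i => b' (i + 1)
      have hx' := hnn fun i => b (i + 1)
      have hy' := hnn fun i => b' (i + 1)
      rw [abs_lt] at h
      cases hb : b 0 <;> cases hb' : b' 0 <;> simp [hb, hb'] at hne h <;> linarith [h.1, h.2]
    have htail : |digitSum l (fun i => b (i + 1)) - digitSum l (fun i => b' (i + 1))|
        < (1 - 2 * l) * l ^ n := by
      rw [h0, add_sub_add_left_eq_sub, ← mul_sub, abs_mul, abs_of_pos hl, pow_succ,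
        ← mul_assoc, mul_comm] at h
      exact lt_of_mul_lt_mul_right h hl.le
    rintro (_ | i) hi
    · exact h0
    · exact ih _ _ htail i (by omega)

theorem hasBallCover_range_digitSum (hl : 0 < l) (hl1 : l < 1) (n : ℕ) :
    HasBallCover (Set.range (digitSum l)) ((1 - l)⁻¹ * l ^ n) (2 ^ n) := by
  classical
  induction n with
  | zero =>
    refine ⟨{0}, by simp, ?_⟩
    rintro _ ⟨b, rfl⟩
    simpa [abs_of_nonneg (digitSum_nonneg hl.le b)] using digitSum_le hl.le hl1 b
  | succ n ih =>
    obtain ⟨T, hT, hcov⟩ := ih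
    refine ⟨T.image (fun c => l * c) ∪ T.image (fun c => 1 + l * c), ?_, ?_⟩
    · have h1 : (T.image (fun c => l * c) ∪ T.image (fun c => 1 + l * c)).card
          ≤ T.card + T.card :=
        (Finset.card_union_le _ _).trans (add_le_add Finset.card_image_le Finset.card_image_le)
      have h2 : ((T.image (fun c => l * c) ∪ T.image (fun c => 1 + l * c)).card : ℝ)
          ≤ T.card + T.card := by exact_mod_cast h1
      rw [pow_succ]; linarith
    · rintro _ ⟨b, rfl⟩
      obtain ⟨c, hc, hb⟩ := Set.mem_iUnion₂.1 (hcov ⟨fun i => b (i + 1), rfl⟩)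
      rw [Metric.mem_closedBall, Real.dist_eq] at hb
      have key : |l * digitSum l (fun i => b (i + 1)) - l * c| ≤ (1 - l)⁻¹ * l ^ (n + 1) := by
        rw [← mul_sub, abs_mul, abs_of_pos hl]
        calc l * |digitSum l (fun i => b (i + 1)) - c| ≤ l * ((1 - l)⁻¹ * l ^ n) := by gcongr
          _ = _ := by ring
      rw [digitSum_eq hl.le hl1]
      cases b 0
      · refine Set.mem_iUnion₂.2
          ⟨l * c, Finset.mem_union_left _ (Finset.mem_image_of_mem _ hc), ?_⟩
        simpa [Real.dist_eq] using key
      · refine Set.mem_iUnion₂.2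
          ⟨1 + l * c, Finset.mem_union_right _ (Finset.mem_image_of_mem _ hc), ?_⟩
        simpa [Real.dist_eq] using key

/-- The range of `digitSum l` has box dimension at most `t` if `2 l ^ t = 1`. -/
theorem eventually_hasBallCover_range_digitSum (hl : 0 < l) (hl1 : l < 1) {t b : ℝ} (ht : 0 < t)
    (hlt : l ^ t = 1 / 2) (hb : t < b) :
    ∀ᶠ r in 𝓝[>] (0 : ℝ), HasBallCover (Set.range (digitSum l)) (r / 2) (r ^ (-b)) := by
  have hL : 0 < (1 - l)⁻¹ := inv_pos.2 (by linarith)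
  set L := 2 * (1 - l)⁻¹ with hLdef
  have hLpos : 0 < L := by positivity
  have hanti : Antitone fun n : ℕ => L * l ^ n := fun m n hmn =>
    mul_le_mul_of_nonneg_left (pow_le_pow_of_le_one hl.le hl1.le hmn) hLpos.le
  have hlim : Tendsto (fun n : ℕ => L * l ^ n) atTop (𝓝 0) := by
    simpa using (tendsto_pow_atTop_nhds_zero_of_lt_one hl.le hl1).const_mul L
  filter_upwards [eventually_exists_between hanti (fun n => by positivity) hlim 0,
    eventually_const_mul_rpow_neg_le (2 * L ^ t) hb, self_mem_nhdsWithin] with r hk hr hr0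
  have hr0 : 0 < r := hr0
  obtain ⟨k, -, hk1, hk2⟩ := hk
  refine (hasBallCover_range_digitSum hl hl1 (k + 1)).mono subset_rfl ?_ (le_trans ?_ hr)
  · rw [hLdef] at hk1; linarith
  · have h1 : r ^ t ≤ L ^ t * (1 / 2) ^ k := by
      calc r ^ t ≤ (L * l ^ k) ^ t := Real.rpow_le_rpow hr0.le hk2.le ht.le
        _ = _ := by
          rw [Real.mul_rpow hLpos.le (by positivity), ← hlt, ← Real.rpow_natCast (l ^ t),
            ← Real.rpow_natCast l, ← Real.rpow_mul hl.le, ← Real.rpow_mul hl.le, mul_comm t]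
    rw [Real.rpow_neg hr0.le, ← div_eq_mul_inv, le_div_iff₀ (by positivity)]
    calc (2 : ℝ) ^ (k + 1) * r ^ t ≤ 2 ^ (k + 1) * (L ^ t * (1 / 2) ^ k) := by gcongr
      _ = 2 * L ^ t * (2 * (1 / 2)) ^ k := by rw [mul_pow]; ring
      _ = _ := by norm_num

/-- The fair coin tossing measure on `0-1` sequences. -/
noncomputable def coinMeasure : Measure (ℕ → Bool) :=
  Measure.infinitePi fun _ => (PMF.uniformOfFintype Bool).toMeasure

instance : IsProbabilityMeasure coinMeasure := by unfold coinMeasure; infer_instance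

theorem coinMeasure_prefix (b : ℕ → Bool) (n : ℕ) :
    coinMeasure {b' | ∀ i < n, b' i = b i} = 2⁻¹ ^ n := by
  have : {b' : ℕ → Bool | ∀ i < n, b' i = b i} = Set.pi (Finset.range n) fun i => {b i} := by
    ext; simp
  rw [this, coinMeasure, Measure.infinitePi_pi _ fun i _ => measurableSet_singleton _]
  simp

/-- The correlation integral of an isometric image of the distribution of random digit sums. -/
theorem correlationIntegral_map_digitSum_le {X : Type*} [MetricSpace X] [MeasurableSpace X]
    [BorelSpace X] {f : ℝ → X} (hf : Isometry f) (hl : 0 < l) (hl2 : l < 1 / 2) (n : ℕ) :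
    correlationIntegral (coinMeasure.map (f ∘ digitSum l)) ((1 - 2 * l) / 2 * l ^ n)
      ≤ 2⁻¹ ^ n := by
  have hm : Measurable (f ∘ digitSum l) :=
    (hf.continuous.comp (continuous_digitSum hl.le (by linarith))).measurable
  refine (lintegral_map_le _ _).trans ?_
  calc _ ≤ ∫⁻ _, 2⁻¹ ^ n ∂coinMeasure := by
        refine lintegral_mono fun b => ?_
        rw [Measure.map_apply hm Metric.isClosed_closedBall.measurableSet, ← coinMeasure_prefix b n]
        refine measure_mono fun b' hb' => ?_
        refine digits_eq_of_abs_sub_lt hl hl2 n b' b ?_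
        have : dist (f (digitSum l b')) (f (digitSum l b)) ≤ (1 - 2 * l) / 2 * l ^ n := hb'
        rw [hf.dist_eq, Real.dist_eq] at this
        -- The halved radius turns the closed ball inequality into the strict one needed to identify
        -- digits.
        have h2 : 0 < (1 - 2 * l) * l ^ n := mul_pos (by linarith) (by positivity)
        linarith
    _ = _ := by simp

theorem le_upperCorrelationDim_of_range_digitSum {X : Type*} [MetricSpace X] [MeasurableSpace X]
    [BorelSpace X] {f : ℝ → X} (hf : Isometry f) (hl : 0 < l) (hl2 : l < 1 / 2) {t : ℝ}
    (ht : 0 < t) (hlt : l ^ t = 1 / 2) {F : Set X} (hF : f '' Set.range (digitSum l) ⊆ F) :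
    (t : EReal) ≤ upperCorrelationDim F := by
  have hl1 : l < 1 := by linarith
  have hm : Measurable (f ∘ digitSum l) :=
    (hf.continuous.comp (continuous_digitSum hl.le hl1)).measurable
  set μ := coinMeasure.map (f ∘ digitSum l) with hμ
  have hprob : IsProbabilityMeasure μ := Measure.isProbabilityMeasure_map hm.aemeasurable
  have hrange : IsCompact (f '' Set.range (digitSum l)) :=
    (isCompact_range (continuous_digitSum hl.le hl1)).image hf.continuous
  have hsupp : μ (f '' Set.range (digitSum l))ᶜ = 0 := by
    rw [hμ, Measure.map_apply hm hrange.isClosed.measurableSet.compl]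
    convert measure_empty (μ := coinMeasure)
    ext b
    simp
  have hFμ : μ Fᶜ = 0 := measure_mono_null (Set.compl_subset_compl.2 hF) hsupp
  refine le_trans ?_ (le_iSup_of_le μ (le_iSup_of_le hprob (le_iSup_of_le hFμ le_rfl)))
  have hc : 0 < (1 - 2 * l) / 2 := by linarith
  apply le_upperCorrelationDimMeasure_of_frequently
  · filter_upwards [eventually_hasBallCover_range_digitSum hl hl1 ht hlt (lt_add_one t),
      self_mem_nhdsWithin] with r hr hr0
    have hr0 : 0 < r := hr0
    have hfull : μ.real (f '' Set.range (digitSum l)) = 1 := by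
      rw [measureReal_def, (prob_compl_eq_zero_iff hrange.isClosed.measurableSet).1 hsupp]; simp
    refine lt_of_lt_of_le ?_ (le_correlationIntegral_of_hasBallCover (hr.image hf)
      (by rw [hfull]; norm_num))
    have : 0 < r ^ (-(t + 1)) := Real.rpow_pos_of_pos hr0 _
    positivity
  · intro b hb
    -- Along these radii the bound `2⁻¹ ^ n` equals a constant times the `t`-th power of the radius.
    have hlim : Tendsto (fun n : ℕ => (1 - 2 * l) / 2 * l ^ n) atTop (𝓝[>] 0) := by
      refine tendsto_nhdsWithin_iff.2 ⟨?_, Eventually.of_forall fun n => ?_⟩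
      · simpa using (tendsto_pow_atTop_nhds_zero_of_lt_one hl.le hl1).const_mul ((1 - 2 * l) / 2)
      · exact mul_pos hc (by positivity)
    refine hlim.frequently (Eventually.frequently ?_)
    filter_upwards [hlim.eventually (eventually_const_mul_rpow_neg_le (((1 - 2 * l) / 2) ^ (-t))
      (show -t < -b by linarith))] with n hn
    rw [neg_neg, neg_neg] at hn
    refine le_trans ?_ hn
    have h1 := ENNReal.toReal_mono (by simp) (correlationIntegral_map_digitSum_le hf hl hl2 n)
    refine h1.trans (le_of_eq ?_)
    rw [Real.mul_rpow hc.le (by positivity), ← mul_assoc, ← Real.rpow_add hc, neg_add_cancel,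
      Real.rpow_zero, one_mul, ← Real.rpow_natCast, ← Real.rpow_mul hl.le, mul_comm,
      Real.rpow_mul hl.le, hlt, Real.rpow_natCast]
    simp

end DigitSums

/-! ### The branching construction for general sizes and gaps -/

section Branching

/-- The `k`-th branching point: new points `branchPoint k + j * r k`, `j < n k`, are created next to
it in step `k`. Every point created is a branching point for infinitely many `k`. -/
noncomputable def branchPoint (r : ℕ → ℝ) (n : ℕ → ℕ) (k : ℕ) : ℝ :=
  if _h : (Nat.unpair (Nat.unpair k).1).1 < k then
    if (Nat.unpair (Nat.unpair k).1).2 < n (Nat.unpair (Nat.unpair k).1).1 then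
      branchPoint r n (Nat.unpair (Nat.unpair k).1).1 +
        (Nat.unpair (Nat.unpair k).1).2 * r (Nat.unpair (Nat.unpair k).1).1
    else 0
  else 0
termination_by k

/-- The points created before step `k`, and the origin. -/
noncomputable def branchFinset (r : ℕ → ℝ) (n : ℕ → ℕ) (k : ℕ) : Finset ℝ :=
  insert 0 ((Finset.range k).biUnion fun i =>
    (Finset.range (n i)).image fun j : ℕ => branchPoint r n i + j * r i)

/-- All points created. -/
def branchSet (r : ℕ → ℝ) (n : ℕ → ℕ) : Set ℝ := ⋃ k, (branchFinset r n k : Set ℝ)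

variable {r : ℕ → ℝ} {n : ℕ → ℕ} {ρ : ℕ → ℝ}

theorem mem_branchFinset {k : ℕ} {x : ℝ} : x ∈ branchFinset r n k ↔
    x = 0 ∨ ∃ i < k, ∃ j < n i, branchPoint r n i + j * r i = x := by
  simp [branchFinset]

theorem mem_branchSet {x : ℝ} : x ∈ branchSet r n ↔
    x = 0 ∨ ∃ i, ∃ j < n i, branchPoint r n i + j * r i = x := by
  simp only [branchSet, Set.mem_iUnion, Finset.mem_coe, mem_branchFinset]
  constructor
  · rintro ⟨k, h | ⟨i, -, h⟩⟩
    · exact Or.inl h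
    · exact Or.inr ⟨i, h⟩
  · rintro (h | ⟨i, h⟩)
    · exact ⟨0, Or.inl h⟩
    · exact ⟨i + 1, Or.inr ⟨i, i.lt_succ_self, h⟩⟩

theorem branchPoint_eq (k : ℕ) : branchPoint r n k = 0 ∨
    ∃ i < k, ∃ j < n i, branchPoint r n k = branchPoint r n i + j * r i := by
  rw [branchPoint]
  split_ifs with h1 h2
  · exact Or.inr ⟨_, h1, _, h2, rfl⟩
  · exact Or.inl rfl
  · exact Or.inl rfl

/-- The free component `m` repeats the same point at infinitely many steps; `i < m` puts these steps
after step `i`, as the recursion requires. -/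
theorem branchPoint_pair {i j m : ℕ} (hm : i < m) (hj : j < n i) :
    branchPoint r n (Nat.pair (Nat.pair i j) m) = branchPoint r n i + j * r i := by
  have h : i < Nat.pair (Nat.pair i j) m := hm.trans_le (Nat.right_le_pair _ _)
  rw [branchPoint]
  simp [h, hj]

theorem exists_branchPoint_eq (hn0 : 0 < n 0) {x : ℝ} (hx : x ∈ branchSet r n) (K : ℕ) :
    ∃ k ≥ K, branchPoint r n k = x := by
  have key : ∀ i j, j < n i → ∃ k ≥ K, branchPoint r n k = branchPoint r n i + j * r i := by
    intro i j hj
    refine ⟨Nat.pair (Nat.pair i j) (max K (i + 1)), ?_, ?_⟩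
    · exact (le_max_left _ _).trans (Nat.right_le_pair _ _)
    · exact branchPoint_pair (by omega) hj
  rcases mem_branchSet.1 hx with rfl | ⟨i, j, hj, rfl⟩
  · obtain ⟨k, hk, h⟩ := key 0 0 hn0
    refine ⟨k, hk, ?_⟩
    rcases branchPoint_eq (r := r) (n := n) 0 with h0 | ⟨i, hi, -⟩
    · rw [h, h0]; simp
    · omega
  · exact key i j hj

theorem branchFinset_succ (k : ℕ) : branchFinset r n (k + 1) = branchFinset r n k ∪
    (Finset.range (n k)).image fun j : ℕ => branchPoint r n k + j * r k := by
  ext x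
  simp only [Finset.mem_union, mem_branchFinset, Finset.mem_image, Finset.mem_range, or_assoc]
  refine or_congr_right ⟨?_, ?_⟩
  · rintro ⟨i, hi, h⟩
    rcases Nat.lt_succ_iff_lt_or_eq.1 hi with hi | rfl
    · exact Or.inl ⟨i, hi, h⟩
    · exact Or.inr h
  · rintro (⟨i, hi, h⟩ | h)
    · exact ⟨i, by omega, h⟩
    · exact ⟨k, by omega, h⟩

theorem card_branchFinset_succ_le (k : ℕ) :
    (branchFinset r n (k + 1)).card ≤ (branchFinset r n k).card + n k := by
  rw [branchFinset_succ]
  refine (Finset.card_union_le _ _).trans (Nat.add_le_add_left ?_ _)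
  simpa using Finset.card_image_le (s := Finset.range (n k))
    (f := fun j : ℕ => branchPoint r n k + j * r k)

theorem mul_le_of_lt (hr : ∀ k, 0 ≤ r k) (hnr : ∀ k, n k * r k ≤ ρ k) {i j : ℕ} (hj : j < n i) :
    j * r i ≤ ρ i := by
  refine le_trans ?_ (hnr i)
  have : (j : ℝ) ≤ n i := by exact_mod_cast hj.le
  exact mul_le_mul_of_nonneg_right this (hr i)

/-- Trace a late point back through its ancestors to one created before step `k`. The term `- ρ i`
makes the induction close: a child adds at most `ρ i` to the slack of its parent `i'`, and `2 * ρ i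
≤ ρ i'`. -/
theorem exists_near_of_le (hr : ∀ k, 0 ≤ r k) (hnr : ∀ k, n k * r k ≤ ρ k)
    (hρ : ∀ k, 2 * ρ (k + 1) ≤ ρ k) (hρ0 : ∀ k, 0 < ρ k) (k i j : ℕ) (hki : k ≤ i) (hj : j < n i) :
    ∃ x ∈ branchFinset r n k, x ≤ branchPoint r n i + j * r i ∧
      branchPoint r n i + j * r i ≤ x + (2 * ρ k - ρ i) := by
  have hanti : Antitone ρ := antitone_nat_of_succ_le fun k => by linarith [hρ k, hρ0 (k + 1)]
  induction i using Nat.strong_induction_on generalizing j with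
  | _ i ih =>
    have hji := mul_le_of_lt hr hnr hj
    have hji0 : 0 ≤ j * r i := mul_nonneg j.cast_nonneg (hr i)
    have hρi := hanti hki
    rcases branchPoint_eq (r := r) (n := n) i with h0 | ⟨i', hi', j', hj', h⟩
    · exact ⟨0, mem_branchFinset.2 (Or.inl rfl), by linarith, by linarith⟩
    · by_cases hk : k ≤ i'
      · obtain ⟨x, hx, h1, h2⟩ := ih i' hi' j' hk hj'
        refine ⟨x, hx, by linarith, ?_⟩
        have h3 : 2 * ρ i ≤ ρ i' := by
          have h4 := hanti (show i' + 1 ≤ i from hi')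
          linarith [hρ i']
        linarith
      · refine ⟨_, mem_branchFinset.2 (Or.inr ⟨i', by omega, j', hj', rfl⟩), by linarith, ?_⟩
        linarith

theorem closure_branchSet_subset (hr : ∀ k, 0 ≤ r k) (hnr : ∀ k, n k * r k ≤ ρ k)
    (hρ : ∀ k, 2 * ρ (k + 1) ≤ ρ k) (hρ0 : ∀ k, 0 < ρ k) (k : ℕ) :
    closure (branchSet r n) ⊆ ⋃ x ∈ branchFinset r n k, Metric.closedBall x (2 * ρ k) := by
  refine closure_minimal ?_ ((branchFinset r n k).finite_toSet.isClosed_biUnion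
    fun _ _ => Metric.isClosed_closedBall)
  intro y hy
  have hself : ∀ y ∈ branchFinset r n k,
      y ∈ ⋃ x ∈ branchFinset r n k, Metric.closedBall x (2 * ρ k) := fun y hy =>
    Set.mem_iUnion₂.2 ⟨y, hy, Metric.mem_closedBall_self (by linarith [hρ0 k])⟩
  rcases mem_branchSet.1 hy with rfl | ⟨i, j, hj, rfl⟩
  · exact hself _ (mem_branchFinset.2 (Or.inl rfl))
  · rcases lt_or_ge i k with hik | hki
    · exact hself _ (mem_branchFinset.2 (Or.inr ⟨i, hik, j, hj, rfl⟩))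
    · obtain ⟨x, hx, h1, h2⟩ := exists_near_of_le hr hnr hρ hρ0 k i j hki hj
      refine Set.mem_iUnion₂.2 ⟨x, hx, ?_⟩
      rw [Metric.mem_closedBall, Real.dist_eq, abs_le]
      constructor <;> linarith [hρ0 i, hρ0 k]

/-- All points new in step `k` lie within `ρ k` of the branching point, so away from it the older
points alone serve at the finer radius. -/
theorem closure_branchSet_sdiff_subset (hr : ∀ k, 0 ≤ r k) (hnr : ∀ k, n k * r k ≤ ρ k)
    (hρ : ∀ k, 2 * ρ (k + 1) ≤ ρ k) (hρ0 : ∀ k, 0 < ρ k) (k : ℕ) :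
    closure (branchSet r n) \ Metric.closedBall (branchPoint r n k) (2 * ρ k) ⊆
      ⋃ x ∈ branchFinset r n k, Metric.closedBall x (2 * ρ (k + 1)) := by
  rintro y ⟨hy, hyk⟩
  obtain ⟨x, hx, hxy⟩ := Set.mem_iUnion₂.1 (closure_branchSet_subset hr hnr hρ hρ0 (k + 1) hy)
  rw [branchFinset_succ, Finset.mem_union] at hx
  rcases hx with hx | hx
  · exact Set.mem_iUnion₂.2 ⟨x, hx, hxy⟩
  · obtain ⟨j, hj, rfl⟩ := Finset.mem_image.1 hx
    refine absurd ?_ hyk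
    have h1 := mul_le_of_lt hr hnr (Finset.mem_range.1 hj)
    have h2 : 0 ≤ j * r k := mul_nonneg j.cast_nonneg (hr k)
    rw [Metric.mem_closedBall, Real.dist_eq, abs_le] at *
    constructor <;> linarith [hρ k, hρ0 k, hxy.1, hxy.2]

theorem isCompact_closure_branchSet (hr : ∀ k, 0 ≤ r k) (hnr : ∀ k, n k * r k ≤ ρ k)
    (hρ : ∀ k, 2 * ρ (k + 1) ≤ ρ k) (hρ0 : ∀ k, 0 < ρ k) :
    IsCompact (closure (branchSet r n)) := by
  refine IsCompact.of_isClosed_subset ?_ isClosed_closure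
    (closure_branchSet_subset hr hnr hρ hρ0 0)
  exact (branchFinset r n 0).finite_toSet.isCompact_biUnion
    fun _ _ => isCompact_closedBall _ _

theorem hasBallCover_closedBall_real {c R q : ℝ} (hq : 0 < q) (hqR : q ≤ R) :
    HasBallCover (Metric.closedBall c R) q (3 * R / q) := by
  classical
  refine ⟨(Finset.range (⌊R / q⌋₊ + 1)).image fun i : ℕ => c - R + (2 * i + 1) * q, ?_, ?_⟩
  · have h1 : (((Finset.range (⌊R / q⌋₊ + 1)).image
        fun i : ℕ => c - R + (2 * i + 1) * q).card : ℝ) ≤ ⌊R / q⌋₊ + 1 := by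
      have := Finset.card_image_le (s := Finset.range (⌊R / q⌋₊ + 1))
        (f := fun i : ℕ => c - R + (2 * i + 1) * q)
      rw [Finset.card_range] at this
      exact_mod_cast this
    have h2 : (⌊R / q⌋₊ : ℝ) ≤ R / q := Nat.floor_le (div_nonneg (by linarith) hq.le)
    have h3 : 1 ≤ R / q := (one_le_div hq).2 hqR
    rw [mul_div_assoc]
    linarith
  · intro y hy
    rw [Metric.mem_closedBall, Real.dist_eq, abs_le] at hy
    have h0 : 0 ≤ (y - (c - R)) / (2 * q) := div_nonneg (by linarith) (by linarith)
    have h1 := Nat.floor_le h0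
    have h2 := Nat.lt_floor_add_one ((y - (c - R)) / (2 * q))
    rw [le_div_iff₀ (by linarith)] at h1
    rw [div_lt_iff₀ (by linarith)] at h2
    refine Set.mem_iUnion₂.2 ⟨_, Finset.mem_image_of_mem _
      (Finset.mem_range.2 (Nat.lt_succ_of_le (Nat.floor_le_floor ?_) :
        ⌊(y - (c - R)) / (2 * q)⌋₊ < _)), ?_⟩
    · rw [div_le_div_iff₀ (by linarith) hq]
      nlinarith
    · rw [Metric.mem_closedBall, Real.dist_eq, abs_le]
      constructor <;> nlinarith

end Branching

/-! ### The construction with superexponentially decreasing sizes -/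

section FactorialScales

/-- The size of the branches in step `k`. -/
noncomputable def branchSize (k : ℕ) : ℝ := (1 / 2) ^ (k + 1).factorial

/-- The spacing of the points created in step `k`. -/
noncomputable def branchGap (s : ℝ) (k : ℕ) : ℝ := branchSize k ^ (1 - s)⁻¹

/-- The number of the points created in step `k`. -/
noncomputable def branchCount (s : ℝ) (k : ℕ) : ℕ := ⌊branchSize k / branchGap s k⌋₊

/-- The closure of the set of all points created: a compact set of packing dimension `s` and upper
correlation dimension `0`. -/
noncomputable def branchCompact (s : ℝ) : Set ℝ :=
  closure (branchSet (branchGap s) (branchCount s))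

theorem branchSize_pos (k : ℕ) : 0 < branchSize k := by unfold branchSize; positivity

theorem branchSize_le_half (k : ℕ) : branchSize k ≤ 1 / 2 := by
  calc branchSize k ≤ (1 / 2) ^ 1 :=
        pow_le_pow_of_le_one (by norm_num) (by norm_num) (Nat.factorial_pos _)
    _ = 1 / 2 := pow_one _

theorem branchSize_succ (k : ℕ) : branchSize (k + 1) = branchSize k ^ (k + 2) := by
  rw [branchSize, branchSize, ← pow_mul, Nat.factorial_succ (k + 1), mul_comm]

theorem two_mul_branchSize_succ_le (k : ℕ) : 2 * branchSize (k + 1) ≤ branchSize k := by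
  have h0 := branchSize_pos k
  have h1 := branchSize_le_half k
  have h2 : branchSize k ^ (k + 2) ≤ branchSize k ^ 2 :=
    pow_le_pow_of_le_one h0.le (by linarith) (by omega)
  rw [branchSize_succ]
  nlinarith

theorem branchSize_antitone : Antitone branchSize :=
  antitone_nat_of_succ_le fun k => by
    linarith [two_mul_branchSize_succ_le k, branchSize_pos (k + 1)]

theorem tendsto_branchSize : Tendsto branchSize atTop (𝓝 0) := by
  refine squeeze_zero (fun k => (branchSize_pos k).le) (fun k => ?_)
    (tendsto_pow_atTop_nhds_zero_of_lt_one (show (0 : ℝ) ≤ 1 / 2 by norm_num) (by norm_num))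
  exact pow_le_pow_of_le_one (by norm_num) (by norm_num)
    (k.le_succ.trans (Nat.self_le_factorial _))

theorem add_two_mul_branchSize_le_one (k : ℕ) : ((k : ℝ) + 2) * branchSize k ≤ 1 := by
  have h1 : branchSize k ≤ (1 / 2) ^ (k + 1) :=
    pow_le_pow_of_le_one (by norm_num) (by norm_num) (Nat.self_le_factorial _)
  have h2 : k + 2 ≤ 2 ^ (k + 1) := Nat.lt_two_pow_self (n := k + 1)
  have h3 : (k : ℝ) + 2 ≤ 2 ^ (k + 1) := by exact_mod_cast h2
  have h0 := (branchSize_pos k).le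
  calc ((k : ℝ) + 2) * branchSize k ≤ 2 ^ (k + 1) * (1 / 2) ^ (k + 1) := by
        gcongr
    _ = 1 := by rw [← mul_pow]; norm_num

variable {s : ℝ}

theorem branchGap_pos (k : ℕ) : 0 < branchGap s k := Real.rpow_pos_of_pos (branchSize_pos k) _

theorem branchGap_rpow (hs1 : s < 1) (k : ℕ) : branchGap s k ^ (1 - s) = branchSize k := by
  rw [branchGap, ← Real.rpow_mul (branchSize_pos k).le, inv_mul_cancel₀ (by linarith),
    Real.rpow_one]

theorem branchGap_le (hs0 : 0 ≤ s) (hs1 : s < 1) (k : ℕ) : branchGap s k ≤ branchSize k := by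
  have h1 : 1 ≤ (1 - s)⁻¹ := (one_le_inv₀ (by linarith)).2 (by linarith)
  have h2 := Real.rpow_le_rpow_of_exponent_ge (branchSize_pos k)
    (by linarith [branchSize_le_half k]) h1
  rwa [Real.rpow_one] at h2

theorem branchGap_antitone (hs1 : s < 1) : Antitone (branchGap s) := fun i j hij =>
  Real.rpow_le_rpow (branchSize_pos j).le (branchSize_antitone hij)
    (inv_nonneg.2 (by linarith))

theorem branchSize_div_branchGap (hs1 : s < 1) (k : ℕ) :
    branchSize k / branchGap s k = branchGap s k ^ (-s) := by
  rw [← branchGap_rpow hs1 k, div_eq_iff (branchGap_pos k).ne']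
  nth_rewrite 3 [← Real.rpow_one (branchGap s k)]
  rw [← Real.rpow_add (branchGap_pos k)]
  ring_nf

theorem branchCount_le (hs1 : s < 1) (k : ℕ) : (branchCount s k : ℝ) ≤ branchGap s k ^ (-s) := by
  rw [← branchSize_div_branchGap hs1]
  exact Nat.floor_le (div_nonneg (branchSize_pos k).le (branchGap_pos k).le)

theorem branchCount_pos (hs0 : 0 ≤ s) (hs1 : s < 1) (k : ℕ) : 0 < branchCount s k :=
  Nat.floor_pos.2 ((one_le_div (branchGap_pos k)).2 (branchGap_le hs0 hs1 k))

theorem le_two_mul_branchCount (hs0 : 0 ≤ s) (hs1 : s < 1) (k : ℕ) :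
    branchGap s k ^ (-s) ≤ 2 * branchCount s k := by
  have h1 := Nat.lt_floor_add_one (branchSize k / branchGap s k)
  rw [branchSize_div_branchGap hs1] at h1
  have h2 : (1 : ℝ) ≤ branchCount s k := by exact_mod_cast branchCount_pos hs0 hs1 k
  rw [branchCount, branchSize_div_branchGap hs1] at *
  linarith

theorem branchCount_mul_branchGap_le (k : ℕ) :
    branchCount s k * branchGap s k ≤ branchSize k := by
  rw [← le_div_iff₀ (branchGap_pos k)]
  exact Nat.floor_le (div_nonneg (branchSize_pos k).le (branchGap_pos k).le)

theorem card_branchFinset_succ_le_div (hs0 : 0 ≤ s) (hs1 : s < 1) (k : ℕ) :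
    ((branchFinset (branchGap s) (branchCount s) (k + 1)).card : ℝ)
      ≤ (k + 2) * (branchGap s k)⁻¹ := by
  have hle : ∀ k, 1 ≤ (branchGap s k)⁻¹ := fun k =>
    (one_le_inv₀ (branchGap_pos k)).2
      (by linarith [branchGap_le hs0 hs1 k, branchSize_le_half k])
  have hcount : ∀ k, (branchCount s k : ℝ) ≤ (branchGap s k)⁻¹ := fun k => by
    refine (Nat.floor_le (div_nonneg (branchSize_pos k).le (branchGap_pos k).le)).trans ?_
    rw [div_eq_mul_inv]
    exact mul_le_of_le_one_left (by linarith [hle k]) (by linarith [branchSize_le_half k])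
  have hsucc : ∀ k, ((branchFinset (branchGap s) (branchCount s) (k + 1)).card : ℝ)
      ≤ (branchFinset (branchGap s) (branchCount s) k).card + branchCount s k := fun k => by
    exact_mod_cast card_branchFinset_succ_le k
  induction k with
  | zero =>
    have h0 : (branchFinset (branchGap s) (branchCount s) 0).card = 1 := by simp [branchFinset]
    have := hsucc 0
    rw [h0] at this
    push_cast at this ⊢
    linarith [hle 0, hcount 0]
  | succ k ih =>
    have hmono : (branchGap s k)⁻¹ ≤ (branchGap s (k + 1))⁻¹ :=
      inv_anti₀ (branchGap_pos _) (branchGap_antitone hs1 k.le_succ)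
    have h1 : ((k : ℝ) + 2) * (branchGap s k)⁻¹ ≤ (k + 2) * (branchGap s (k + 1))⁻¹ := by gcongr
    have := hsucc (k + 1)
    push_cast
    linarith [hcount (k + 1)]

/-- The number of points existing before step `k + 1` is at most a fixed negative power of
`branchSize k`, whereas `branchSize (k + 1)` is its power with exponent `k + 2`, which is unbounded.
-/
theorem eventually_card_branchFinset_le (hs0 : 0 ≤ s) (hs1 : s < 1) {ε : ℝ} (hε : 0 < ε) :
    ∀ᶠ k in atTop, ((branchFinset (branchGap s) (branchCount s) k).card : ℝ)
      ≤ (4 * branchSize k) ^ (-ε) := by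
  rw [← map_add_atTop_eq_nat 1, eventually_map]
  have hlarge : ∀ᶠ k : ℕ in atTop, 1 + (1 - s)⁻¹ ≤ k * ε :=
    (tendsto_natCast_atTop_atTop.atTop_mul_const hε).eventually_ge_atTop _
  filter_upwards [hlarge] with k hk
  have h0 := branchSize_pos k
  have h1 := branchSize_le_half k
  have h2 : (k : ℝ) + 2 ≤ (branchSize k)⁻¹ := by
    rw [← one_div, le_div_iff₀ h0]
    exact add_two_mul_branchSize_le_one k
  have h3 : 4 * branchSize (k + 1) ≤ branchSize k ^ k := by
    rw [branchSize_succ, pow_add]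
    have h5 : 0 < branchSize k ^ k := by positivity
    have h6 : 4 * branchSize k ^ 2 ≤ 1 := by nlinarith
    nlinarith
  have h4 : 0 < branchSize (k + 1) := branchSize_pos _
  calc ((branchFinset (branchGap s) (branchCount s) (k + 1)).card : ℝ)
      ≤ (k + 2) * (branchGap s k)⁻¹ := card_branchFinset_succ_le_div hs0 hs1 k
    _ ≤ (branchSize k)⁻¹ * (branchGap s k)⁻¹ := by
        have := (branchGap_pos (s := s) k).le
        gcongr
    _ = branchSize k ^ (-(1 + (1 - s)⁻¹)) := by
        rw [branchGap, ← Real.rpow_neg h0.le, ← Real.rpow_neg_one, ← Real.rpow_add h0]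
        ring_nf
    _ ≤ branchSize k ^ (-(k * ε)) :=
        Real.rpow_le_rpow_of_exponent_ge h0 (by linarith) (by linarith)
    _ = (branchSize k ^ k) ^ (-ε) := by
        rw [← Real.rpow_natCast, ← Real.rpow_mul h0.le]; ring_nf
    _ ≤ (4 * branchSize (k + 1)) ^ (-ε) :=
        Real.rpow_le_rpow_of_nonpos (by positivity) h3 (by linarith)

theorem isCompact_branchCompact : IsCompact (branchCompact s) :=
  isCompact_closure_branchSet (fun k => (branchGap_pos k).le) branchCount_mul_branchGap_le
    two_mul_branchSize_succ_le branchSize_pos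

/-- At each small scale `q`, choose the step `k` with `4 ρ (k + 1) ≤ q < 4 ρ k`. -/
theorem eventually_exists_branch_cover (hs0 : 0 ≤ s) (hs1 : s < 1) {ε : ℝ} (hε : 0 < ε) (K : ℕ) :
    ∀ᶠ q in 𝓝[>] (0 : ℝ), ∃ k, K ≤ k ∧ 4 * branchSize (k + 1) ≤ q ∧ q < 4 * branchSize k ∧
      ((branchFinset (branchGap s) (branchCount s) k).card : ℝ) ≤ q ^ (-ε) ∧
      HasBallCover (branchCompact s \ Metric.closedBall
        (branchPoint (branchGap s) (branchCount s) k) (2 * branchSize k)) (q / 2) (q ^ (-ε)) := by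
  obtain ⟨K', hK'⟩ := eventually_atTop.1 (eventually_card_branchFinset_le hs0 hs1 hε)
  have hlim : Tendsto (fun k => 4 * branchSize k) atTop (𝓝 0) := by
    simpa using tendsto_branchSize.const_mul 4
  filter_upwards [eventually_exists_between (a := fun k => 4 * branchSize k)
    (branchSize_antitone.const_mul (by norm_num)) (fun k => mul_pos four_pos (branchSize_pos k))
    hlim (max K K'), self_mem_nhdsWithin] with q hq hq0
  have hq0 : 0 < q := hq0
  obtain ⟨k, hk, hk1, hk2⟩ := hq
  have hcard : ((branchFinset (branchGap s) (branchCount s) k).card : ℝ) ≤ q ^ (-ε) :=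
    (hK' k ((le_max_right _ _).trans hk)).trans
      (Real.rpow_le_rpow_of_nonpos hq0 hk2.le (by linarith))
  refine ⟨k, (le_max_left _ _).trans hk, hk1, hk2, hcard, ?_⟩
  refine HasBallCover.mono ⟨_, hcard, closure_branchSet_sdiff_subset
    (fun k => (branchGap_pos k).le) branchCount_mul_branchGap_le two_mul_branchSize_succ_le
    branchSize_pos k⟩ subset_rfl (by linarith) le_rfl

theorem eventually_hasBallCover_branchCompact_sdiff (hs0 : 0 ≤ s) (hs1 : s < 1) {ε η : ℝ}
    (hε : 0 < ε) (hη : 0 < η) :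
    ∀ᶠ q in 𝓝[>] (0 : ℝ), ∃ x,
      HasBallCover (branchCompact s \ Metric.closedBall x η) (q / 2) (q ^ (-ε)) := by
  obtain ⟨K, hK⟩ := eventually_atTop.1
    (tendsto_branchSize.eventually (ge_mem_nhds (show 0 < η / 2 by positivity)))
  filter_upwards [eventually_exists_branch_cover hs0 hs1 hε K] with q hq
  obtain ⟨k, hk, -, -, -, hcov⟩ := hq
  refine ⟨_, hcov.mono (Set.sdiff_subset_sdiff_right
    (Metric.closedBall_subset_closedBall ?_)) le_rfl le_rfl⟩
  linarith [hK k hk]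

theorem eventually_hasBallCover_branchCompact (hs0 : 0 < s) (hs1 : s < 1) {b : ℝ} (hb : s < b) :
    ∀ᶠ q in 𝓝[>] (0 : ℝ), HasBallCover (branchCompact s) (q / 2) (q ^ (-b)) := by
  filter_upwards [eventually_exists_branch_cover hs0.le hs1 hs0 0,
    eventually_const_mul_rpow_neg_le 13 hb, self_mem_nhdsWithin] with q hq hqb hq0
  have hq0 : 0 < q := hq0
  have hqs : 0 < q ^ (-s) := Real.rpow_pos_of_pos hq0 _
  obtain ⟨k, -, hk1, hk2, hcard, hcov⟩ := hq
  -- Above the gap, the branch is covered as an interval, at cost `12 * branchSize k / q ≤ 12 * q ^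
  -- (-s)`. Below it, its points are counted singly. With `ε = s` for the rest, `13` suffices in
  -- both cases.
  rcases le_or_gt (branchGap s k) q with h | h
  · have hball := hasBallCover_closedBall_real
      (c := branchPoint (branchGap s) (branchCount s) k) (R := 2 * branchSize k) (half_pos hq0)
      (by linarith)
    refine (hcov.union hball).mono (fun x hx => ?_) le_rfl (le_trans ?_ hqb)
    · by_cases hxk : x ∈ Metric.closedBall (branchPoint (branchGap s) (branchCount s) k)
        (2 * branchSize k)
      · exact Or.inr hxk
      · exact Or.inl ⟨hx, hxk⟩
    · have h1 : branchSize k ≤ q * q ^ (-s) := by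
        rw [← branchGap_rpow hs1 k]
        calc branchGap s k ^ (1 - s) ≤ q ^ (1 - s) :=
              Real.rpow_le_rpow (branchGap_pos k).le h (by linarith)
          _ = q * q ^ (-s) := by rw [sub_eq_add_neg, Real.rpow_add hq0, Real.rpow_one]
      have h2 : 3 * (2 * branchSize k) / (q / 2) ≤ 12 * q ^ (-s) := by
        rw [div_le_iff₀ (half_pos hq0)]
        linarith
      linarith
  · refine HasBallCover.mono ⟨_, le_rfl, closure_branchSet_subset
      (fun k => (branchGap_pos k).le) branchCount_mul_branchGap_le two_mul_branchSize_succ_le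
      branchSize_pos (k + 1)⟩ subset_rfl (by linarith) (le_trans ?_ hqb)
    have h1 : ((branchFinset (branchGap s) (branchCount s) (k + 1)).card : ℝ)
      ≤ (branchFinset (branchGap s) (branchCount s) k).card + branchCount s k := by
      exact_mod_cast card_branchFinset_succ_le k
    have h2 := branchCount_le hs1 k
    have h3 : branchGap s k ^ (-s) ≤ q ^ (-s) :=
      Real.rpow_le_rpow_of_nonpos hq0 h.le (by linarith)
    linarith

theorem exists_separated_branchSet (hs0 : 0 < s) (hs1 : s < 1) {x : ℝ}
    (hx : x ∈ branchSet (branchGap s) (branchCount s)) {O : Set ℝ} (hO : IsOpen O) (hxO : x ∈ O)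
    {u : ℝ} (hu : u < s) {δ : ℝ} (hδ : 0 < δ) :
    ∃ q, 0 < q ∧ q ≤ δ ∧ ∃ (n : ℕ) (y : ℕ → ℝ),
      (∀ j < n, y j ∈ O ∩ branchSet (branchGap s) (branchCount s)) ∧
      (∀ i < n, ∀ j < n, i ≠ j → q ≤ dist (y i) (y j)) ∧ 1 ≤ n * (q / 4) ^ u := by
  obtain ⟨η, hη, hηO⟩ := Metric.isOpen_iff.1 hO x hxO
  have hgap : Tendsto (branchGap s) atTop (𝓝[>] 0) :=
    tendsto_nhdsWithin_iff.2 ⟨squeeze_zero (fun k => (branchGap_pos k).le)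
      (branchGap_le hs0.le hs1) tendsto_branchSize, Eventually.of_forall branchGap_pos⟩
  -- The `2` pays for the floor in `branchCount`, and `4 ^ u` for the radius `q / 4`.
  obtain ⟨K, hK⟩ := eventually_atTop.1
    ((tendsto_branchSize.eventually (gt_mem_nhds (lt_min hη hδ))).and
      (hgap.eventually (eventually_const_mul_rpow_neg_le (2 * 4 ^ u) hu)))
  obtain ⟨k, hk, rfl⟩ := exists_branchPoint_eq (branchCount_pos hs0.le hs1 0) hx K
  obtain ⟨hk1, hk2⟩ := hK k hk
  have hr := branchGap_pos (s := s) k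
  refine ⟨branchGap s k, hr,
    (branchGap_le hs0.le hs1 k).trans (hk1.le.trans (min_le_right _ _)), branchCount s k,
    fun j => branchPoint (branchGap s) (branchCount s) k + j * branchGap s k, ?_, ?_, ?_⟩
  · refine fun j hj => ⟨hηO ?_, mem_branchSet.2 (Or.inr ⟨k, j, hj, rfl⟩)⟩
    have h1 := mul_le_of_lt (fun k => (branchGap_pos (s := s) k).le) branchCount_mul_branchGap_le hj
    rw [Metric.mem_ball, Real.dist_eq, add_sub_cancel_left,
      abs_of_nonneg (mul_nonneg j.cast_nonneg hr.le)]
    exact h1.trans_lt (hk1.trans_le (min_le_left _ _))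
  · intro i _ j _ hij
    rw [Real.dist_eq, add_sub_add_left_eq_sub, ← sub_mul, abs_mul, abs_of_pos hr]
    have h1 : (1 : ℝ) ≤ |(i : ℝ) - j| := by
      have : (i : ℤ) - j ≠ 0 := by omega
      exact_mod_cast Int.one_le_abs this
    nlinarith
  · have h1 := hk2.trans (le_two_mul_branchCount hs0.le hs1 k)
    have h4 : (0 : ℝ) < 4 ^ u := by positivity
    have hp : 0 < branchGap s k ^ u := Real.rpow_pos_of_pos hr _
    rw [Real.rpow_neg hr.le, ← div_eq_mul_inv, div_le_iff₀ hp] at h1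
    rw [Real.div_rpow hr.le (by norm_num), mul_div_assoc', le_div_iff₀ h4]
    linarith

end FactorialScales

/-! ### The union of the two compact sets -/

theorem mainTheorem4 (d : ℕ) (hd : 1 ≤ d) (s t : ℝ) (ht : 0 < t) (hts : t < s) (hs : s < 1) :
    ∃ E : Set (EuclideanSpace ℝ (Fin d)),
      IsCompact E ∧ upperCorrelationDim E = (t : EReal) ∧ packingDim E = ENNReal.ofReal s := by
  have hs0 : 0 < s := ht.trans hts
  have : Nonempty (Fin d) := ⟨⟨0, hd⟩⟩
  set φ : ℝ → EuclideanSpace ℝ (Fin d) := fun a => EuclideanSpace.single ⟨0, hd⟩ a with hφdef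
  have hφ : Isometry φ := Isometry.of_dist_eq fun a b => PiLp.dist_single_same 2 (fun _ => ℝ) _ a b
  set l : ℝ := (1 / 2) ^ t⁻¹ with hldef
  have hl : 0 < l := by positivity
  have hlt : l ^ t = 1 / 2 := by
    rw [hldef, ← Real.rpow_mul (by norm_num), inv_mul_cancel₀ ht.ne', Real.rpow_one]
  -- Here `t < 1` enters: it separates the two halves of `K`.
  have hl2 : l < 1 / 2 := by
    have h1 : 1 < t⁻¹ := (one_lt_inv₀ ht).2 (by linarith)
    have := Real.rpow_lt_rpow_of_exponent_gt (show (0 : ℝ) < 1 / 2 by norm_num) (by norm_num) h1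
    rwa [Real.rpow_one] at this
  have hl1 : l < 1 := by linarith
  set K : Set ℝ := Set.range (digitSum l) with hK
  refine ⟨φ '' (branchCompact s ∪ K), ?_, le_antisymm ?_ ?_, le_antisymm ?_ ?_⟩
  · exact (isCompact_branchCompact.union
      (isCompact_range (continuous_digitSum hl.le hl1))).image hφ.continuous
  · refine upperCorrelationDim_le_of_hasBallCover ht.le fun b hb η hη => ?_
    obtain ⟨b', hb', hb'b⟩ := exists_between hb
    filter_upwards [eventually_hasBallCover_branchCompact_sdiff hs0.le hs
      (show 0 < b' by linarith) hη, eventually_hasBallCover_range_digitSum hl hl1 ht hlt hb',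
      eventually_const_mul_rpow_neg_le 2 hb'b] with q ⟨x, hE⟩ hK' hq
    refine ⟨φ x, ((hE.union hK').image hφ).mono ?_ le_rfl (by linarith)⟩
    rintro _ ⟨⟨y, hy, rfl⟩, hyx⟩
    refine Set.mem_image_of_mem φ (hy.imp_left fun h => ⟨h, fun hyx' => hyx ?_⟩)
    rw [Metric.mem_closedBall, hφ.dist_eq]
    exact hyx'
  · exact le_upperCorrelationDim_of_range_digitSum hφ hl hl2 ht hlt
      (Set.image_mono Set.subset_union_right)
  · refine packingDim_le_of_hasBallCover hs0.le fun b hb => ?_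
    obtain ⟨b', hb', hb'b⟩ := exists_between hb
    filter_upwards [eventually_hasBallCover_branchCompact hs0 hs hb',
      eventually_hasBallCover_range_digitSum hl hl1 ht hlt (hts.trans hb'),
      eventually_const_mul_rpow_neg_le 2 hb'b] with q hE hK' hq
    exact ((hE.union hK').image hφ).mono subset_rfl le_rfl (by linarith)
  · refine le_packingDim (G := φ '' branchCompact s)
      (D := φ '' branchSet (branchGap s) (branchCount s))
      (isCompact_branchCompact.image hφ.continuous).isClosed
      (Set.image_mono Set.subset_union_left) ?_ (image_closure_subset_closure_image hφ.continuous)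
      (Set.image_mono subset_closure) ?_
    · exact ⟨φ 0, 0, mem_branchSet.2 (Or.inl rfl), rfl⟩
    · rintro _ ⟨x, hx, rfl⟩ O hO hxO u hu δ hδ
      obtain ⟨q, hq, hqδ, n, y, hy, hsep, hn⟩ := exists_separated_branchSet hs0 hs hx
        (hO.preimage hφ.continuous) hxO hu hδ
      refine ⟨q, hq, hqδ, n, φ ∘ y, fun j hj => ⟨(hy j hj).1, _, subset_closure (hy j hj).2, rfl⟩,
        fun i hi j hj hij => ?_, hn⟩
      rw [Function.comp_apply, Function.comp_apply, hφ.dist_eq]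
      exact hsep i hi j hj hij
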